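/- Let $F$ be a real or complex Banach space with an unconditional (Schauder) basis $(e_i)_{i\in\mathbb N}$. Suppose that (∗) every normalized block basis $u_k=\sum_{i=j_k+1}^{j_{k+1}} a_i e_i$ of $(e_i)$ (where $j_1<j_2<\cdots$, the $a_i$ are scalars, and $\|u_k\|=1$ for all $k$) such that $a_i\to 0$ has a subsequence equivalent to the unit vector basis of $c_0$; that is, there are $k_1<k_2<\cdots$ and constants $c,C>0$ with $c\max_n|b_n|\le\bigl\|\sum_n b_n u_{k_n}\bigr\|\le C\max_n|b_n|$ for all finitely supported scalar sequences $(b_n)$. Suppose also that $\bigl\|\sum_{i\in A_k}e_i\bigr\|\to\infty$ whenever $(A_k)$ is a sequence of nonempty finite subsets of $\mathbb N$ such that $\max A_k<\min A_{k+1}$ for all $k$ and $|A_k|\to\infty$. Then the dual space $F'$ is $\ell^1$-saturated: every closed infinite-dimensional subspace of $F'$ contains a subspace isomorphic (linearly homeomorphic) to $\ell^1$. -/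

import Mathlib

open Filter Topology
open scoped ZeroAtInfty

noncomputable section

/-- The `n`-th unit vector of `c_0`, the Banach space `C₀(ℕ, 𝕜)` of null sequences with the
supremum norm. -/
def c0UnitVector (𝕜 : Type*) [RCLike 𝕜] (n : ℕ) : C₀(ℕ, 𝕜) where
  toFun := Pi.single n 1
  continuous_toFun := continuous_of_discreteTopology
  zero_at_infty' := by
    rw [Filter.cocompact_eq_cofinite]
    refine tendsto_const_nhds.congr' ?_
    filter_upwards [(Set.finite_singleton n).compl_mem_cofinite] with m hm
    exact (Pi.single_eq_of_ne (M := fun _ : ℕ => 𝕜) (by simpa using hm) 1).symm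

/-- Two sequences `x` and `y` in normed spaces are equivalent: the correspondence
`∑ a i • y i ↦ ∑ a i • x i` between finite linear combinations is bounded in both directions. -/
def SeqEquivalent (𝕜 : Type*) [RCLike 𝕜] {X Y : Type*}
    [NormedAddCommGroup X] [NormedSpace 𝕜 X] [NormedAddCommGroup Y] [NormedSpace 𝕜 Y]
    (x : ℕ → X) (y : ℕ → Y) : Prop :=
  ∃ c C : ℝ, 0 < c ∧ 0 < C ∧ ∀ (s : Finset ℕ) (a : ℕ → 𝕜),
    c * ‖∑ i ∈ s, a i • y i‖ ≤ ‖∑ i ∈ s, a i • x i‖ ∧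
      ‖∑ i ∈ s, a i • x i‖ ≤ C * ‖∑ i ∈ s, a i • y i‖

/-- The `k`-th block `∑_{j k ≤ i < j (k+1)} a i • e i`. -/
def block {𝕜 : Type*} [RCLike 𝕜] {X : Type*} [NormedAddCommGroup X] [NormedSpace 𝕜 X]
    (e : ℕ → X) (j : ℕ → ℕ) (a : ℕ → 𝕜) (k : ℕ) : X :=
  ∑ i ∈ Finset.Ico (j k) (j (k + 1)), a i • e i

/-- Property (∗): every normalized block basis of `e` whose coefficients tend to `0` has a
subsequence equivalent to the unit vector basis of `c_0`. -/
def PropertyStar (𝕜 : Type*) [RCLike 𝕜] {X : Type*} [NormedAddCommGroup X] [NormedSpace 𝕜 X]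
    (e : ℕ → X) : Prop :=
  ∀ (j : ℕ → ℕ) (a : ℕ → 𝕜), StrictMono j → (∀ k, ‖block e j a k‖ = 1) →
    Tendsto a atTop (𝓝 0) →
    ∃ φ : ℕ → ℕ, StrictMono φ ∧
      SeqEquivalent 𝕜 (fun k => block e j a (φ k)) (c0UnitVector 𝕜)

/-- `‖∑_{i ∈ A k} e i‖ → ∞` whenever `(A k)` is a sequence of nonempty finite subsets of `ℕ` with
`max (A k) < min (A (k+1))` for all `k` and `|A k| → ∞`. -/
def BlowsUpOnSuccessiveSets {X : Type*} [NormedAddCommGroup X] (e : ℕ → X) : Prop :=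
  ∀ A : ℕ → Finset ℕ, (∀ k, (A k).Nonempty) →
    (∀ k, ∀ m ∈ A k, ∀ n ∈ A (k + 1), m < n) →
    Tendsto (fun k => (A k).card) atTop atTop →
    Tendsto (fun k => ‖∑ i ∈ A k, e i‖) atTop atTop

/-- `X` is `Y`-saturated: every closed infinite-dimensional subspace of `X` contains a subspace
linearly homeomorphic to `Y`. -/
def IsSaturated (𝕜 : Type*) [RCLike 𝕜] (Y X : Type*)
    [NormedAddCommGroup Y] [NormedSpace 𝕜 Y] [NormedAddCommGroup X] [NormedSpace 𝕜 X] : Prop :=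
  ∀ M : Submodule 𝕜 X, IsClosed (M : Set X) → ¬ FiniteDimensional 𝕜 M →
    ∃ N : Submodule 𝕜 X, N ≤ M ∧ Nonempty (N ≃L[𝕜] Y)

end

/-!
Write `f i = e i / ‖e i‖`. Property (∗) and the growth condition say that blocks with small
coefficients look like `c₀`, and that a bounded vector has boundedly many large coefficients.

Averaging bounded blocks over longer and longer intervals makes the coefficients tend to `0`, so
(∗) excludes bounded blocks on which functionals of bounded norm are uniformly positive
(`PropertyStar.not_forall_exists_le_re`). Two consequences follow. First, the basis is shrinking
(`UnconditionalSchauderBasis.exists_forall_norm_apply_sub_proj_le`), so gliding humps are available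
in the dual. Secondly, on an infinite-dimensional subspace `M` of the dual the norm is not
equivalent, even far out, to `x ↦ sup |x (f i)|`: otherwise a gliding hump in `M` would behave like
the basis of `c₀`, and some subsequence of `f` would behave like the basis of `ℓ¹`
(`exists_mem_norm_eq_one_forall_norm_apply_basis_le`).

Hence `M` contains an almost disjoint sequence of norm-one functionals `x k` whose values on the
`f i` are as small as desired. A vector that almost norms `x k` has few large coefficients by the
growth condition, and `x k` is tiny on these, so they can be dropped by unconditionality
(`exists_small_coeff_le_norm_apply`). The resulting blocks have coefficients tending to `0`, so (∗)
yields a subsequence with an upper `c₀`-estimate, and by duality the corresponding `x k` satisfy a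
lower `ℓ¹`-estimate (`sum_norm_le_mul_norm_sum_of_norm_sum_le`) and span a copy of `ℓ¹`
(`exists_le_nonempty_equiv_lp_one`).
-/

/-! ### Blocks and property (∗) -/

/-- Builds a sequence of data, each living on the interval between two consecutive terms of a
strictly increasing sequence, by choosing the intervals one after the other. -/
theorem exists_strictMono_forall_consecutive {D : Type*} (Q : ℕ → ℕ → ℕ → D → Prop) (n₀ : ℕ)
    (h : ∀ k n, n₀ ≤ n → ∃ m d, n < m ∧ Q k n m d) :
    ∃ (j : ℕ → ℕ) (d : ℕ → D), StrictMono j ∧ j 0 = n₀ ∧ ∀ k, Q k (j k) (j (k + 1)) (d k) := by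
  choose m d hm hQ using h
  let J : ℕ → {n // n₀ ≤ n} := fun k =>
    Nat.rec ⟨n₀, le_rfl⟩ (fun k n => ⟨m k n n.2, n.2.trans (hm k n n.2).le⟩) k
  exact ⟨fun k => (J k).1, fun k => d k (J k).1 (J k).2, strictMono_nat_of_lt_succ fun k =>
    hm k (J k).1 (J k).2, rfl, fun k => hQ k (J k).1 (J k).2⟩

theorem StrictMono.eq_of_mem_Ico_succ {j : ℕ → ℕ} (hj : StrictMono j) {i k l : ℕ}
    (hk : i ∈ Finset.Ico (j k) (j (k + 1))) (hl : i ∈ Finset.Ico (j l) (j (l + 1))) : k = l := by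
  rw [Finset.mem_Ico] at hk hl
  have h₁ := hj.lt_iff_lt.1 (hk.1.trans_lt hl.2)
  have h₂ := hj.lt_iff_lt.1 (hl.1.trans_lt hk.2)
  omega

/-- Coefficients given separately on each block come from a single sequence. -/
theorem StrictMono.exists_glue {R : Type*} [Zero R] {j : ℕ → ℕ} (hj : StrictMono j)
    (α : ℕ → ℕ → R) :
    ∃ a : ℕ → R, (∀ k, ∀ i ∈ Finset.Ico (j k) (j (k + 1)), a i = α k i) ∧
      ∀ i, a i = 0 ∨ ∃ k, i ∈ Finset.Ico (j k) (j (k + 1)) ∧ a i = α k i := by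
  classical
  let a : ℕ → R := fun i =>
    if h : ∃ k, i ∈ Finset.Ico (j k) (j (k + 1)) then α h.choose i else 0
  have ha : ∀ k, ∀ i ∈ Finset.Ico (j k) (j (k + 1)), a i = α k i := by
    intro k i hi
    have h : ∃ k, i ∈ Finset.Ico (j k) (j (k + 1)) := ⟨k, hi⟩
    simp only [a, dif_pos h, hj.eq_of_mem_Ico_succ h.choose_spec hi]
  refine ⟨a, ha, fun i => ?_⟩
  by_cases h : ∃ k, i ∈ Finset.Ico (j k) (j (k + 1))
  · obtain ⟨k, hk⟩ := h
    exact .inr ⟨k, hk, ha k i hk⟩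
  · exact .inl (dif_neg h)

section Block

variable {𝕜 : Type*} [RCLike 𝕜] {X : Type*} [NormedAddCommGroup X] [NormedSpace 𝕜 X]

theorem block_congr (e : ℕ → X) {j : ℕ → ℕ} {a b : ℕ → 𝕜} {k : ℕ}
    (h : ∀ i ∈ Finset.Ico (j k) (j (k + 1)), a i = b i) : block e j a k = block e j b k :=
  Finset.sum_congr rfl fun i hi => by rw [h i hi]

theorem block_const_mul (e : ℕ → X) (j : ℕ → ℕ) (c : 𝕜) (a : ℕ → 𝕜) (k : ℕ) :
    block e j (fun i => c * a i) k = c • block e j a k := by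
  simp only [block, mul_smul, Finset.smul_sum]

/-- Merging consecutive blocks adds them up. -/
theorem block_comp (e : ℕ → X) {j T : ℕ → ℕ} (hj : StrictMono j) (hT : StrictMono T)
    (a : ℕ → 𝕜) (n : ℕ) :
    block e (j ∘ T) a n = ∑ k ∈ Finset.Ico (T n) (T (n + 1)), block e j a k := by
  have key : ∀ p q, p ≤ q → ∑ i ∈ Finset.Ico (j p) (j q), a i • e i =
      ∑ k ∈ Finset.Ico p q, block e j a k := by
    intro p q hpq
    induction q, hpq using Nat.le_induction with
    | base => simp
    | succ q hpq ih =>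
      rw [Finset.sum_Ico_succ_top hpq, ← ih, block,
        Finset.sum_Ico_consecutive _ (hj.monotone hpq) (hj.monotone q.le_succ)]
  exact key _ _ (hT.monotone n.le_succ)

theorem sum_smul_c0UnitVector_apply (s : Finset ℕ) (b : ℕ → 𝕜) (m : ℕ) :
    (∑ k ∈ s, b k • c0UnitVector 𝕜 k) m = if m ∈ s then b m else 0 := by
  classical
  induction s using Finset.induction_on with
  | empty => simp
  | insert k s hk ih =>
    rw [Finset.sum_insert hk, ZeroAtInftyContinuousMap.add_apply, ih,
      ZeroAtInftyContinuousMap.smul_apply]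
    have : c0UnitVector 𝕜 k m = Pi.single (M := fun _ => 𝕜) k 1 m := rfl
    rw [this]
    rcases eq_or_ne m k with rfl | h
    · simp [hk]
    · simp [h]

theorem norm_sum_smul_c0UnitVector_le (s : Finset ℕ) (b : ℕ → 𝕜) (hb : ∀ k ∈ s, ‖b k‖ ≤ 1) :
    ‖∑ k ∈ s, b k • c0UnitVector 𝕜 k‖ ≤ 1 := by
  rw [← ZeroAtInftyContinuousMap.norm_toBCF_eq_norm]
  refine (BoundedContinuousFunction.norm_le zero_le_one).2 fun m => ?_
  change ‖(∑ k ∈ s, b k • c0UnitVector 𝕜 k) m‖ ≤ 1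
  rw [sum_smul_c0UnitVector_apply]
  split_ifs with h
  · exact hb m h
  · simp

/-- The form in which property (∗) is used: blocks need only be bounded and bounded away from `0`,
and only the upper `c₀`-estimate matters. -/
theorem PropertyStar.exists_subseq_norm_sum_le {e : ℕ → X} (h : PropertyStar 𝕜 e) {j : ℕ → ℕ}
    (hj : StrictMono j) {α : ℕ → ℕ → 𝕜} {δ : ℕ → ℝ} (hδ : Tendsto δ atTop (𝓝 0))
    (hα : ∀ k, ∀ i ∈ Finset.Ico (j k) (j (k + 1)), ‖α k i‖ ≤ δ k) {c B : ℝ} (hc : 0 < c)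
    (hlow : ∀ k, c ≤ ‖block e j (α k) k‖) (hup : ∀ k, ‖block e j (α k) k‖ ≤ B) :
    ∃ φ : ℕ → ℕ, StrictMono φ ∧ ∃ C : ℝ, 0 < C ∧ ∀ (s : Finset ℕ) (b : ℕ → 𝕜),
      (∀ k ∈ s, ‖b k‖ ≤ 1) → ‖∑ k ∈ s, b k • block e j (α (φ k)) (φ k)‖ ≤ C := by
  set u : ℕ → X := fun k => block e j (α k) k with hu
  have hupos : ∀ k, 0 < ‖u k‖ := fun k => hc.trans_le (hlow k)
  have hB : 0 < B := (hupos 0).trans_le (hup 0)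
  obtain ⟨a, ha, ha'⟩ := hj.exists_glue fun k i => ((‖u k‖⁻¹ : ℝ) : 𝕜) * α k i
  have hblock : ∀ k, block e j a k = ((‖u k‖⁻¹ : ℝ) : 𝕜) • u k := fun k => by
    rw [block_congr e (ha k), block_const_mul]
  have hnorm : ∀ k, ‖block e j a k‖ = 1 := fun k => by
    rw [hblock, norm_smul, RCLike.norm_ofReal, abs_of_pos (inv_pos.2 (hupos k)),
      inv_mul_cancel₀ (hupos k).ne']
  have hlim : Tendsto a atTop (𝓝 0) := by
    rw [Metric.tendsto_atTop]
    intro ε hε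
    obtain ⟨K, hK⟩ := (Metric.tendsto_atTop.1 hδ) (c * ε) (by positivity)
    refine ⟨j K, fun i hi => ?_⟩
    rw [dist_zero_right]
    rcases ha' i with h0 | ⟨k, hk, hki⟩
    · simpa [h0] using hε
    · have hKk : K ≤ k := Nat.lt_succ_iff.1 (hj.lt_iff_lt.1 (hi.trans_lt (Finset.mem_Ico.1 hk).2))
      have h1 := hK k hKk
      rw [Real.dist_eq, sub_zero] at h1
      have h2 : ‖α k i‖ < c * ε := (hα k i hk).trans_lt ((le_abs_self _).trans_lt h1)
      rw [hki, norm_mul, RCLike.norm_ofReal, abs_of_pos (inv_pos.2 (hupos k)), inv_mul_lt_iff₀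
        (hupos k)]
      exact h2.trans_le (by gcongr; exact hlow k)
  obtain ⟨φ, hφ, c', C, -, hC, hφC⟩ := h j a hj hnorm hlim
  refine ⟨φ, hφ, C * B, by positivity, fun s b hb => ?_⟩
  have h1 := (hφC s fun k => b k * ((‖u (φ k)‖ / B : ℝ) : 𝕜)).2
  have h2 : ‖∑ k ∈ s, (b k * ((‖u (φ k)‖ / B : ℝ) : 𝕜)) • c0UnitVector 𝕜 k‖ ≤ 1 := by
    refine norm_sum_smul_c0UnitVector_le s _ fun k hk => ?_
    rw [norm_mul, RCLike.norm_ofReal, abs_of_pos (div_pos (hupos _) hB)]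
    exact mul_le_one₀ (hb k hk) (by positivity) ((div_le_one hB).2 (hup _))
  have h3 : ∑ k ∈ s, (b k * ((‖u (φ k)‖ / B : ℝ) : 𝕜)) • block e j a (φ k) =
      ((B⁻¹ : ℝ) : 𝕜) • ∑ k ∈ s, b k • u (φ k) := by
    rw [Finset.smul_sum]
    refine Finset.sum_congr rfl fun k _ => ?_
    rw [hblock, smul_smul, smul_smul]
    congr 1
    have : ((‖u (φ k)‖ : ℝ) : 𝕜) ≠ 0 := by exact_mod_cast (hupos (φ k)).ne'
    push_cast
    field_simp
  rw [h3, norm_smul, RCLike.norm_ofReal, abs_of_pos (inv_pos.2 hB), inv_mul_le_iff₀ hB] at h1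
  calc ‖∑ k ∈ s, b k • u (φ k)‖ ≤ B * (C * _) := h1
    _ ≤ B * (C * 1) := by gcongr
    _ = C * B := by ring

/-- Property (∗) excludes bounded blocks with bounded coefficients on which functionals of bounded
norm are uniformly positive, in particular blocks equivalent to the unit vector basis of `ℓ¹`:
averages of more and more of them have coefficients tending to `0`, so some subsequence of the
averages has bounded partial sums, whereas the functionals take arbitrarily large values on these
sums. -/
theorem PropertyStar.not_forall_exists_le_re {e : ℕ → X} (h : PropertyStar 𝕜 e) {j : ℕ → ℕ}
    (hj : StrictMono j) {a : ℕ → 𝕜} {A B c D : ℝ} (hA : ∀ i, ‖a i‖ ≤ A)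
    (hB : ∀ k, ‖block e j a k‖ ≤ B) (hc : 0 < c) :
    ¬ ∀ N, ∃ x : StrongDual 𝕜 X, ‖x‖ ≤ D ∧ ∀ k < N, c ≤ RCLike.re (x (block e j a k)) := by
  intro hx
  have hre : ∀ (x : StrongDual 𝕜 X) (y : X), ‖x‖ ≤ D → RCLike.re (x y) ≤ D * ‖y‖ := fun x y hxD =>
    (RCLike.re_le_norm _).trans (x.le_of_opNorm_le hxD y)
  have hD : 0 < D := by
    obtain ⟨x, hxD, hx1⟩ := hx 1
    have h1 := (hx1 0 one_pos).trans (hre x _ hxD)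
    by_contra! hD
    have := mul_nonpos_of_nonpos_of_nonneg hD (norm_nonneg (block e j a 0))
    linarith
  have hT : StrictMono fun n : ℕ => n ^ 2 := fun m n hmn => Nat.pow_lt_pow_left hmn two_ne_zero
  -- The interval `[n², (n + 1)²)` contains `2 * n + 1` indices.
  let r : ℕ → ℝ := fun n => (2 * n + 1)⁻¹
  have hr : ∀ n, 0 < r n := fun n => by positivity
  have hcard : ∀ n : ℕ, ((Finset.Ico (n ^ 2) ((n + 1) ^ 2)).card : ℝ) = 2 * n + 1 := fun n => by
    have : (n + 1) ^ 2 - n ^ 2 = 2 * n + 1 := by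
      rw [add_sq]; omega
    rw [Nat.card_Ico, this]; push_cast; ring
  have hblock : ∀ n, block e (j ∘ fun n => n ^ 2) (fun i => ((r n : ℝ) : 𝕜) * a i) n =
      ((r n : ℝ) : 𝕜) • ∑ k ∈ Finset.Ico (n ^ 2) ((n + 1) ^ 2), block e j a k := fun n => by
    rw [block_const_mul, block_comp e hj hT]
  have hlow : ∀ n (x : StrongDual 𝕜 X),
      (∀ k < (n + 1) ^ 2, c ≤ RCLike.re (x (block e j a k))) →
      c ≤ RCLike.re (x (block e (j ∘ fun n => n ^ 2) (fun i => ((r n : ℝ) : 𝕜) * a i) n)) := by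
    intro n x hx
    rw [hblock, map_smul, map_sum, smul_eq_mul, RCLike.re_ofReal_mul, map_sum]
    calc c = r n * ((Finset.Ico (n ^ 2) ((n + 1) ^ 2)).card • c) := by
          rw [nsmul_eq_mul, hcard, ← mul_assoc, inv_mul_cancel₀ (by positivity), one_mul]
      _ ≤ _ := by
          gcongr ?_ * ?_
          exact Finset.card_nsmul_le_sum _ _ _ fun k hk => hx k (Finset.mem_Ico.1 hk).2
  have hA0 : Tendsto (fun n => r n * A) atTop (𝓝 0) := by
    have h1 : Tendsto r atTop (𝓝 0) := by
      refine tendsto_inv_atTop_zero.comp (tendsto_atTop_mono (fun n => ?_)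
        tendsto_natCast_atTop_atTop)
      have : (0 : ℝ) ≤ n := n.cast_nonneg
      linarith
    simpa using h1.mul_const A
  obtain ⟨φ, hφ, C, hC, hφC⟩ := h.exists_subseq_norm_sum_le (j := j ∘ fun n => n ^ 2)
    (hj.comp hT) (α := fun n i => ((r n : ℝ) : 𝕜) * a i) hA0 (c := c / D) (B := B)
    (fun n i _ => by
      rw [norm_mul, RCLike.norm_ofReal, abs_of_pos (hr n)]
      exact mul_le_mul_of_nonneg_left (hA i) (hr n).le)
    (by positivity)
    (fun n => by
      obtain ⟨x, hxD, hx1⟩ := hx ((n + 1) ^ 2)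
      rw [div_le_iff₀' hD]
      exact (hlow n x hx1).trans (hre x _ hxD))
    (fun n => by
      rw [hblock, norm_smul, RCLike.norm_ofReal, abs_of_pos (hr n)]
      calc _ ≤ r n * ((Finset.Ico (n ^ 2) ((n + 1) ^ 2)).card * B) := by
            gcongr ?_ * ?_
            exact (norm_sum_le_of_le _ fun k _ => hB k).trans (by simp)
        _ = B := by rw [hcard, ← mul_assoc, inv_mul_cancel₀ (by positivity), one_mul])
  obtain ⟨N, hN⟩ := exists_nat_gt (D * C / c)
  obtain ⟨x, hxD, hx1⟩ := hx ((φ N + 1) ^ 2)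
  have h1 := hφC (Finset.range N) (fun _ => 1) (by simp)
  have h2 : N * c ≤ RCLike.re (x (∑ k ∈ Finset.range N, (1 : 𝕜) •
      block e (j ∘ fun n => n ^ 2) (fun i => ((r (φ k) : ℝ) : 𝕜) * a i) (φ k))) := by
    simp only [one_smul]
    rw [map_sum, map_sum]
    calc N * c = (Finset.range N).card • c := by simp
      _ ≤ _ := by
        refine Finset.card_nsmul_le_sum _ _ _ fun k hk => hlow (φ k) x fun l hl => hx1 l ?_
        have : φ k < φ N := hφ (Finset.mem_range.1 hk)
        exact hl.trans (Nat.pow_lt_pow_left (by omega) two_ne_zero)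
  rw [div_lt_iff₀ hc] at hN
  have h3 := h2.trans (hre x _ hxD)
  have h4 := mul_le_mul_of_nonneg_left h1 hD.le
  linarith

end Block

/-! ### Producing copies of `ℓ¹` -/

section EllOne

variable {𝕜 : Type*} [RCLike 𝕜] {X : Type*} [NormedAddCommGroup X] [NormedSpace 𝕜 X]

/-- Functionals that are almost biorthogonal to a sequence with an upper `c₀`-estimate satisfy a
lower `ℓ¹`-estimate. -/
theorem sum_norm_le_mul_norm_sum_of_norm_sum_le {x : ℕ → StrongDual 𝕜 X} {w : ℕ → X} {c C : ℝ}
    (hc : 0 < c)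
    (hC : ∀ (s : Finset ℕ) (θ : ℕ → 𝕜), (∀ k ∈ s, ‖θ k‖ ≤ 1) → ‖∑ k ∈ s, θ k • w k‖ ≤ C)
    (hlow : ∀ k l, l < k → x k (w l) = 0) (hdiag : ∀ k, c ≤ ‖x k (w k)‖)
    (htail : ∀ (k : ℕ) (s : Finset ℕ) (θ : ℕ → 𝕜), (∀ l ∈ s, k < l ∧ ‖θ l‖ ≤ 1) →
      ‖x k (∑ l ∈ s, θ l • w l)‖ ≤ c / 2) (s : Finset ℕ) (b : ℕ → 𝕜) :
    c / 2 * ∑ k ∈ s, ‖b k‖ ≤ C * ‖∑ k ∈ s, b k • x k‖ := by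
  have hne : ∀ k, x k (w k) ≠ 0 := fun k => norm_pos_iff.1 (hc.trans_le (hdiag k))
  -- If `b k = 0`, division by zero makes `θ k = 0`.
  let θ : ℕ → 𝕜 := fun k => ((c * ‖b k‖ : ℝ) : 𝕜) / (b k * x k (w k))
  have hθ : ∀ k, ‖θ k‖ ≤ 1 := by
    intro k
    rw [norm_div, norm_mul, RCLike.norm_ofReal, abs_of_nonneg (by positivity)]
    refine div_le_one_of_le₀ ?_ (by positivity)
    rw [mul_comm]
    gcongr
    exact hdiag k
  have hbθ : ∀ k, b k * (θ k * x k (w k)) = ((c * ‖b k‖ : ℝ) : 𝕜) := by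
    intro k
    rcases eq_or_ne (b k) 0 with h | h
    · simp [h]
    · have := hne k
      simp only [θ]
      field_simp
  have hsplit : ∀ k ∈ s, x k (∑ l ∈ s, θ l • w l) =
      θ k * x k (w k) + x k (∑ l ∈ s with k < l, θ l • w l) := by
    intro k hk
    rw [← Finset.sum_filter_add_sum_filter_not s (fun l => k < l), map_add, add_comm]
    congr 1
    rw [map_sum, Finset.sum_eq_single k]
    · simp
    · intro l hl hlk
      have : l < k := lt_of_le_of_ne (not_lt.1 (Finset.mem_filter.1 hl).2) hlk
      simp [hlow k l this]
    · intro h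
      exact absurd (Finset.mem_filter.2 ⟨hk, lt_irrefl k⟩) h
  have hsum : (∑ k ∈ s, b k • x k) (∑ l ∈ s, θ l • w l) =
      ((c * ∑ k ∈ s, ‖b k‖ : ℝ) : 𝕜) + ∑ k ∈ s, b k * x k (∑ l ∈ s with k < l, θ l • w l) := by
    rw [sum_apply, Finset.mul_sum, RCLike.ofReal_sum, ← Finset.sum_add_distrib]
    refine Finset.sum_congr rfl fun k hk => ?_
    rw [smul_apply, hsplit k hk, smul_eq_mul, mul_add, hbθ]
  have herr : ‖∑ k ∈ s, b k * x k (∑ l ∈ s with k < l, θ l • w l)‖ ≤ c / 2 * ∑ k ∈ s, ‖b k‖ := by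
    rw [Finset.mul_sum]
    refine norm_sum_le_of_le s fun k _ => ?_
    rw [norm_mul, mul_comm]
    gcongr
    exact htail k _ θ fun l hl => ⟨(Finset.mem_filter.1 hl).2, hθ l⟩
  have hnn : 0 ≤ ∑ k ∈ s, ‖b k‖ := Finset.sum_nonneg fun k _ => norm_nonneg _
  have h1 : ‖((c * ∑ k ∈ s, ‖b k‖ : ℝ) : 𝕜)‖ = c * ∑ k ∈ s, ‖b k‖ := by
    rw [RCLike.norm_ofReal, abs_of_nonneg (by positivity)]
  have h2 := norm_sub_le_norm_add ((c * ∑ k ∈ s, ‖b k‖ : ℝ) : 𝕜)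
    (∑ k ∈ s, b k * x k (∑ l ∈ s with k < l, θ l • w l))
  rw [h1, ← hsum] at h2
  have h3 := (∑ k ∈ s, b k • x k).le_opNorm (∑ l ∈ s, θ l • w l)
  have h4 := mul_le_mul_of_nonneg_left (hC s θ fun k _ => hθ k) (norm_nonneg (∑ k ∈ s, b k • x k))
  linarith

/-- A bounded sequence with a lower `ℓ¹`-estimate spans a copy of `ℓ¹`. -/
theorem exists_le_nonempty_equiv_lp_one [CompleteSpace X] {M : Submodule 𝕜 X}
    (hM : IsClosed (M : Set X)) {x : ℕ → X} (hxM : ∀ k, x k ∈ M) (hx : ∀ k, ‖x k‖ ≤ 1) {c : ℝ}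
    (hc : 0 < c) (hlow : ∀ (n : ℕ) (b : ℕ → 𝕜),
      c * ∑ k ∈ Finset.range n, ‖b k‖ ≤ ‖∑ k ∈ Finset.range n, b k • x k‖) :
    ∃ N : Submodule 𝕜 X, N ≤ M ∧ Nonempty (N ≃L[𝕜] lp (fun _ : ℕ => 𝕜) 1) := by
  have hnorm : ∀ b : lp (fun _ : ℕ => 𝕜) 1, HasSum (fun k => ‖b k‖) ‖b‖ := fun b => by
    simpa using lp.hasSum_norm (p := 1) (by simp) b
  have hle : ∀ (b : lp (fun _ : ℕ => 𝕜) 1) k, ‖b k • x k‖ ≤ ‖b k‖ := fun b k => by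
    rw [norm_smul]
    exact mul_le_of_le_one_right (norm_nonneg _) (hx k)
  have hsum : ∀ b : lp (fun _ : ℕ => 𝕜) 1, Summable fun k => b k • x k := fun b =>
    Summable.of_norm_bounded (hnorm b).summable (hle b)
  let T : lp (fun _ : ℕ => 𝕜) 1 →L[𝕜] X := LinearMap.mkContinuous
    { toFun := fun b => ∑' k, b k • x k
      map_add' := fun b b' => by
        rw [← (hsum b).tsum_add (hsum b')]
        exact tsum_congr fun k => add_smul (b k) (b' k) (x k)
      map_smul' := fun r b => by
        rw [RingHom.id_apply, ← (hsum b).tsum_const_smul]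
        exact tsum_congr fun k => mul_smul r (b k) (x k) } 1
    fun b => by
      rw [one_mul]
      exact tsum_of_norm_bounded (hnorm b) (hle b)
  have hT : ∀ b, HasSum (fun k => b k • x k) (T b) := fun b => (hsum b).hasSum
  have hTlow : ∀ b, c * ‖b‖ ≤ ‖T b‖ := fun b =>
    le_of_tendsto_of_tendsto' ((hnorm b).tendsto_sum_nat.const_mul c)
      (hT b).tendsto_sum_nat.norm fun n => hlow n b
  have hanti : AntilipschitzWith (Real.toNNReal c⁻¹) T :=
    T.antilipschitz_of_bound fun b => by
      rw [Real.coe_toNNReal _ (inv_pos.2 hc).le, inv_mul_eq_div, le_div_iff₀' hc]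
      exact hTlow b
  refine ⟨T.range, ?_, ⟨(T.equivRange hanti.injective
    (hanti.isClosed_range T.uniformContinuous)).symm⟩⟩
  rintro _ ⟨b, rfl⟩
  exact hM.mem_of_tendsto (hT b).tendsto_sum_nat (Eventually.of_forall fun n =>
    M.sum_mem fun k _ => M.smul_mem _ (hxM k))

end EllOne

/-! ### Unconditional bases whose finite sums blow up -/

theorem sum_abs_le_two_mul_of_forall_subset {ι : Type*} {s : Finset ι} {r : ι → ℝ} {B : ℝ}
    (h : ∀ A ⊆ s, |∑ i ∈ A, r i| ≤ B) : ∑ i ∈ s, |r i| ≤ 2 * B := by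
  rw [← Finset.sum_filter_add_sum_filter_not s (fun i => 0 ≤ r i)]
  have h1 := (abs_le.1 (h _ (Finset.filter_subset (fun i => 0 ≤ r i) s))).2
  have h2 := (abs_le.1 (h _ (Finset.filter_subset (fun i => ¬ 0 ≤ r i) s))).1
  have h3 : ∑ i ∈ s with 0 ≤ r i, |r i| = ∑ i ∈ s with 0 ≤ r i, r i :=
    Finset.sum_congr rfl fun i hi => abs_of_nonneg (Finset.mem_filter.1 hi).2
  have h4 : ∑ i ∈ s with ¬ 0 ≤ r i, |r i| = - ∑ i ∈ s with ¬ 0 ≤ r i, r i := by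
    rw [← Finset.sum_neg_distrib]
    exact Finset.sum_congr rfl fun i hi => abs_of_neg (not_le.1 (Finset.mem_filter.1 hi).2)
  linarith

theorem sum_norm_le_four_mul_of_forall_subset {𝕜 : Type*} [RCLike 𝕜] {ι : Type*} {s : Finset ι}
    {z : ι → 𝕜} {B : ℝ} (h : ∀ A ⊆ s, ‖∑ i ∈ A, z i‖ ≤ B) : ∑ i ∈ s, ‖z i‖ ≤ 4 * B := by
  have h1 : ∑ i ∈ s, |RCLike.re (z i)| ≤ 2 * B := sum_abs_le_two_mul_of_forall_subset fun A hA => by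
    rw [← map_sum]; exact (RCLike.abs_re_le_norm _).trans (h A hA)
  have h2 : ∑ i ∈ s, |RCLike.im (z i)| ≤ 2 * B := sum_abs_le_two_mul_of_forall_subset fun A hA => by
    rw [← map_sum]; exact (RCLike.abs_im_le_norm _).trans (h A hA)
  calc ∑ i ∈ s, ‖z i‖ ≤ ∑ i ∈ s, (|RCLike.re (z i)| + |RCLike.im (z i)|) :=
        Finset.sum_le_sum fun i _ => by
          conv_lhs => rw [← RCLike.re_add_im (z i)]
          refine (norm_add_le _ _).trans ?_
          rw [norm_mul, RCLike.norm_ofReal, RCLike.norm_ofReal, RCLike.norm_I]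
          gcongr
          exact mul_le_of_le_one_right (abs_nonneg _) (by split_ifs <;> norm_num)
    _ ≤ 4 * B := by rw [Finset.sum_add_distrib]; linarith

section Basis

variable {𝕜 : Type*} [RCLike 𝕜] {F : Type*} [NormedAddCommGroup F] [NormedSpace 𝕜 F]
  (e : UnconditionalSchauderBasis ℕ 𝕜 F)

theorem UnconditionalSchauderBasis.norm_basis_pos (i : ℕ) : 0 < ‖e.basis i‖ :=
  norm_pos_iff.2 (e.linearIndependent.ne_zero i)

theorem UnconditionalSchauderBasis.tendsto_proj_range (y : F) :
    Tendsto (fun n => e.proj (Finset.range n) y) atTop (𝓝 y) :=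
  (e.tendsto_proj y).comp tendsto_finset_range

variable {K : ℝ} (hK : ∀ A : Finset ℕ, ‖e.proj A‖ ≤ K)

include hK

theorem UnconditionalSchauderBasis.norm_coord_mul_norm_basis_le (i : ℕ) (u : F) :
    ‖e.coord i u‖ * ‖e.basis i‖ ≤ K * ‖u‖ := by
  rw [← norm_smul]
  simpa using (e.proj {i}).le_of_opNorm_le (hK {i}) u

/-- Dividing out coefficients that are bounded below costs only a constant. -/
theorem UnconditionalSchauderBasis.mul_norm_sum_basis_le (u : F) {A : Finset ℕ} {δ : ℝ}
    (hA : ∀ i ∈ A, δ ≤ ‖e.coord i u‖) :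
    δ * ‖∑ i ∈ A, e.basis i‖ ≤ 4 * (K * ‖u‖) := by
  rcases le_or_gt δ 0 with hδ | hδ
  · have hK0 : 0 ≤ K := (norm_nonneg _).trans (hK ∅)
    exact (mul_nonpos_of_nonpos_of_nonneg hδ (norm_nonneg _)).trans (by positivity)
  obtain ⟨g, hg, hgx⟩ := exists_dual_vector'' 𝕜 (∑ i ∈ A, e.basis i)
  have h1 : ∑ i ∈ A, ‖g (e.coord i u • e.basis i)‖ ≤ 4 * (K * ‖u‖) := by
    refine sum_norm_le_four_mul_of_forall_subset fun B _ => ?_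
    rw [← map_sum, ← e.proj_apply]
    calc _ ≤ 1 * ‖e.proj B u‖ := g.le_of_opNorm_le hg _
      _ ≤ K * ‖u‖ := by rw [one_mul]; exact (e.proj B).le_of_opNorm_le (hK B) u
  calc δ * ‖∑ i ∈ A, e.basis i‖ = δ * ‖∑ i ∈ A, g (e.basis i)‖ := by
        rw [← map_sum, hgx, RCLike.norm_ofReal, abs_norm]
    _ ≤ δ * ∑ i ∈ A, ‖g (e.basis i)‖ := by gcongr; exact norm_sum_le _ _
    _ ≤ ∑ i ∈ A, ‖g (e.coord i u • e.basis i)‖ := by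
        rw [Finset.mul_sum]
        refine Finset.sum_le_sum fun i hi => ?_
        rw [map_smul, norm_smul]
        gcongr
        exact hA i hi
    _ ≤ _ := h1

/-- By unconditionality, finite sums of basis vectors over arbitrary, not only successive, sets of
large cardinality are large. -/
theorem BlowsUpOnSuccessiveSets.exists_forall_card_lt (h : BlowsUpOnSuccessiveSets e.basis)
    (B : ℝ) :
    ∃ N : ℕ, ∀ A : Finset ℕ, ‖∑ i ∈ A, e.basis i‖ ≤ B → A.card < N := by
  by_contra! hcon
  choose A hAB hA using hcon
  obtain ⟨b, hb⟩ : ∃ b : ℕ → ℕ, ∀ k, (A (b k + k + 1)).sup id < b (k + 1) :=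
    ⟨fun k => Nat.rec 0 (fun k n => (A (n + k + 1)).sup id + 1) k, fun k => Nat.lt_succ_self _⟩
  let S : ℕ → Finset ℕ := fun k => {i ∈ A (b k + k + 1) | b k ≤ i}
  have hcard : ∀ k, k + 1 ≤ (S k).card := by
    intro k
    have h1 := Finset.card_filter_add_card_filter_not (s := A (b k + k + 1)) (fun i => b k ≤ i)
    have h2 : ({i ∈ A (b k + k + 1) | ¬ b k ≤ i} : Finset ℕ).card ≤ b k := by
      refine (Finset.card_le_card (t := Finset.range (b k)) fun i hi => ?_).trans
        (Finset.card_range _).le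
      exact Finset.mem_range.2 (not_le.1 (Finset.mem_filter.1 hi).2)
    have h3 := hA (b k + k + 1)
    change k + 1 ≤ ({i ∈ A (b k + k + 1) | b k ≤ i} : Finset ℕ).card
    omega
  have hlim := h S (fun k => Finset.card_pos.1 (k.succ_pos.trans_le (hcard k)))
    (fun k m hm n hn => by
      have h1 : m ≤ (A (b k + k + 1)).sup id := Finset.le_sup (f := id) (Finset.mem_filter.1 hm).1
      exact h1.trans_lt ((hb k).trans_le (Finset.mem_filter.1 hn).2))
    (tendsto_atTop_mono (fun k => (Nat.le_succ k).trans (hcard k)) tendsto_id)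
  obtain ⟨k, hk⟩ := (hlim.eventually_gt_atTop (K * B)).exists
  refine hk.not_ge ?_
  have h1 : e.proj (S k) (∑ i ∈ A (b k + k + 1), e.basis i) = ∑ i ∈ S k, e.basis i := by
    classical
    rw [map_sum, Finset.sum_filter]
    refine Finset.sum_congr rfl fun i hi => ?_
    rw [e.proj_apply_basis_mem]
    congr 1
    simp [S, hi]
  have hK0 : 0 ≤ K := (norm_nonneg _).trans (hK ∅)
  rw [← h1]
  exact ((e.proj (S k)).le_of_opNorm_le (hK _) _).trans (by gcongr; exact hAB _)

theorem BlowsUpOnSuccessiveSets.exists_pos_forall_le_norm (h : BlowsUpOnSuccessiveSets e.basis) :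
    ∃ β : ℝ, 0 < β ∧ ∀ i, β ≤ ‖e.basis i‖ := by
  obtain ⟨N, hN⟩ := h.exists_forall_card_lt e hK 1
  let S : Set ℕ := {i | ‖e.basis i‖ < 1 / (N + 1)}
  have hS : S.Finite := by
    by_contra hS
    obtain ⟨A, hAS, hA⟩ := Set.Infinite.exists_subset_card_eq hS N
    refine (hN A ?_).ne hA
    calc ‖∑ i ∈ A, e.basis i‖ ≤ A.card • (1 / (N + 1) : ℝ) :=
          (norm_sum_le _ _).trans (Finset.sum_le_card_nsmul _ _ _ fun i hi => (hAS hi).le)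
      _ ≤ 1 := by
          rw [hA, nsmul_eq_mul, mul_one_div]
          exact div_le_one_of_le₀ (by linarith) (by positivity)
  obtain ⟨β, hβ, hβS⟩ : ∃ β : ℝ, 0 < β ∧ ∀ i ∈ S, β ≤ ‖e.basis i‖ := by
    rcases S.eq_empty_or_nonempty with h0 | h0
    · exact ⟨1, one_pos, by simp [h0]⟩
    · obtain ⟨i, -, hi⟩ := Set.exists_min_image S (fun i => ‖e.basis i‖) hS h0
      exact ⟨‖e.basis i‖, e.norm_basis_pos i, hi⟩
  refine ⟨min β (1 / (N + 1)), lt_min hβ (by positivity), fun i => ?_⟩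
  by_cases hi : i ∈ S
  · exact (min_le_left _ _).trans (hβS i hi)
  · exact (min_le_right _ _).trans (not_lt.1 hi)

/-- The basis is shrinking. Otherwise some functional would be uniformly positive on bounded
successive blocks, which property (∗) excludes. -/
theorem UnconditionalSchauderBasis.exists_forall_norm_apply_sub_proj_le
    (hstar : PropertyStar 𝕜 e.basis) {β : ℝ} (hβ : 0 < β) (hβe : ∀ i, β ≤ ‖e.basis i‖)
    (x : StrongDual 𝕜 F) {ε : ℝ} (hε : 0 < ε) :
    ∃ n₀, ∀ n ≥ n₀, ∀ y, ‖x (y - e.proj (Finset.range n) y)‖ ≤ ε * ‖y‖ := by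
  by_contra! hcon
  have hK0 : 0 ≤ K := (norm_nonneg _).trans (hK ∅)
  have step : ∀ k n : ℕ, 0 ≤ n → ∃ (m : ℕ) (α : ℕ → 𝕜), n < m ∧ ((∀ i, ‖α i‖ ≤ K / β) ∧
      ‖∑ i ∈ Finset.Ico n m, α i • e.basis i‖ ≤ K ∧
      ε ≤ RCLike.re (x (∑ i ∈ Finset.Ico n m, α i • e.basis i))) := by
    intro _ n _
    obtain ⟨p, hnp, y, hy⟩ := hcon n
    have hlim : Tendsto (fun m => ‖x (e.proj (Finset.range m) y - e.proj (Finset.range p) y)‖)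
        atTop (𝓝 ‖x (y - e.proj (Finset.range p) y)‖) :=
      ((x.continuous.tendsto _).comp ((e.tendsto_proj_range y).sub_const _)).norm
    obtain ⟨m, hm, hpm⟩ := ((hlim.eventually_const_lt hy).and (eventually_gt_atTop p)).exists
    have hdiff : e.proj (Finset.range m) y - e.proj (Finset.range p) y =
        e.proj (Finset.Ico p m) y := by
      simp only [e.proj_apply, Finset.sum_Ico_eq_sub _ hpm.le]
    rw [hdiff] at hm
    set v := e.proj (Finset.Ico p m) y with hv
    have hxv : x v ≠ 0 := norm_pos_iff.1 (lt_of_le_of_lt (by positivity) hm)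
    have hy0 : 0 < ‖y‖ := by
      rw [norm_pos_iff]
      rintro rfl
      simp [hv] at hxv
    -- This scalar normalises `y` and makes the value of `x` positive.
    let t : 𝕜 := ((ε : ℝ) : 𝕜) / x v
    have ht : ‖t‖ * ‖y‖ ≤ 1 := by
      rw [norm_div, RCLike.norm_ofReal, abs_of_pos hε, div_mul_eq_mul_div]
      exact div_le_one_of_le₀ hm.le (norm_nonneg _)
    let α : ℕ → 𝕜 := fun i => if p ≤ i then t * e.coord i y else 0
    have hsum : ∑ i ∈ Finset.Ico n m, α i • e.basis i = t • v := by
      rw [hv, e.proj_apply, Finset.smul_sum, ← Finset.sum_Ico_consecutive _ hnp hpm.le,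
        Finset.sum_eq_zero, zero_add]
      · refine Finset.sum_congr rfl fun i hi => ?_
        simp only [α, if_pos (Finset.mem_Ico.1 hi).1, mul_smul]
      · intro i hi
        simp only [α, if_neg (not_le.2 (Finset.mem_Ico.1 hi).2), zero_smul]
    refine ⟨m, α, hnp.trans_lt hpm, fun i => ?_, ?_, ?_⟩
    · by_cases hi : p ≤ i
      · simp only [α, if_pos hi, norm_mul]
        rw [le_div_iff₀ hβ]
        calc ‖t‖ * ‖e.coord i y‖ * β ≤ ‖t‖ * (‖e.coord i y‖ * ‖e.basis i‖) := by
              rw [mul_assoc]; gcongr; exact hβe i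
          _ ≤ ‖t‖ * (K * ‖y‖) :=
              mul_le_mul_of_nonneg_left (e.norm_coord_mul_norm_basis_le hK i y) (norm_nonneg _)
          _ = K * (‖t‖ * ‖y‖) := by ring
          _ ≤ K := mul_le_of_le_one_right hK0 ht
      · simp only [α, if_neg hi, norm_zero]
        positivity
    · rw [hsum, norm_smul]
      calc ‖t‖ * ‖v‖ ≤ ‖t‖ * (K * ‖y‖) := by
            gcongr; exact (e.proj _).le_of_opNorm_le (hK _) y
        _ = K * (‖t‖ * ‖y‖) := by ring
        _ ≤ K := mul_le_of_le_one_right hK0 ht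
    · rw [hsum, map_smul, smul_eq_mul, div_mul_cancel₀ _ hxv, RCLike.ofReal_re]
  obtain ⟨j, α, hj, -, hQ⟩ := exists_strictMono_forall_consecutive _ 0 step
  obtain ⟨a, ha, ha'⟩ := hj.exists_glue α
  have hblock : ∀ k, block e.basis j a k = block e.basis j (α k) k := fun k =>
    block_congr _ (ha k)
  refine hstar.not_forall_exists_le_re hj (a := a) (A := K / β) (B := K) (D := ‖x‖) (fun i => ?_)
    (fun k => ?_) hε fun N => ⟨x, le_rfl, fun k _ => ?_⟩
  · rcases ha' i with h | ⟨k, -, h⟩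
    · rw [h, norm_zero]; positivity
    · rw [h]; exact (hQ k).1 i
  · rw [hblock]; exact (hQ k).2.1
  · rw [hblock]; exact (hQ k).2.2

end Basis

/-! ### Infinite-dimensional subspaces of the dual -/

section Dual

variable {𝕜 : Type*} [RCLike 𝕜] {F : Type*} [NormedAddCommGroup F] [NormedSpace 𝕜 F]

theorem exists_mem_norm_eq_one_forall_lt_apply_eq_zero {M : Submodule 𝕜 (StrongDual 𝕜 F)}
    (hM : ¬ FiniteDimensional 𝕜 M) (v : ℕ → F) (n : ℕ) :
    ∃ x ∈ M, ‖x‖ = 1 ∧ ∀ i < n, x (v i) = 0 := by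
  let f : M →ₗ[𝕜] (Fin n → 𝕜) :=
    { toFun := fun x i => (x : StrongDual 𝕜 F) (v i)
      map_add' := fun _ _ => rfl
      map_smul' := fun _ _ => rfl }
  have hf : ¬ Function.Injective f := fun hf => hM (FiniteDimensional.of_injective f hf)
  rw [injective_iff_map_eq_zero] at hf
  push Not at hf
  obtain ⟨x, hx, hx0⟩ := hf
  have hx0' : ‖(x : StrongDual 𝕜 F)‖ ≠ 0 := by simpa using hx0
  refine ⟨((‖(x : StrongDual 𝕜 F)‖⁻¹ : ℝ) : 𝕜) • (x : StrongDual 𝕜 F), M.smul_mem _ x.2, ?_,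
    fun i hi => ?_⟩
  · rw [norm_smul, RCLike.norm_ofReal, abs_inv, abs_norm, inv_mul_cancel₀ hx0']
  · have : (x : StrongDual 𝕜 F) (v i) = 0 := congr_fun hx ⟨i, hi⟩
    rw [smul_apply, this, smul_zero]

theorem sum_range_mul_half_pow_le {ε : ℝ} (hε : 0 ≤ ε) (N : ℕ) :
    ∑ k ∈ Finset.range N, ε * (1 / 2) ^ k ≤ 2 * ε := by
  rw [← Finset.mul_sum, mul_comm]
  gcongr
  exact sum_geometric_two_le N

variable (e : UnconditionalSchauderBasis ℕ 𝕜 F)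

/-- An infinite-dimensional subspace `M` of the dual contains norm-one functionals that are small
on all normalised basis vectors. Otherwise the norm of `M` would, far out, be equivalent to the
supremum over the normalised basis vectors; almost disjoint norm-one functionals in `M` would then
have bounded sums, and these are uniformly positive on a sequence of multiples of basis vectors,
contradicting property (∗). -/
theorem exists_mem_norm_eq_one_forall_norm_apply_basis_le (hstar : PropertyStar 𝕜 e.basis)
    {β : ℝ} (hβ : 0 < β) (hβe : ∀ i, β ≤ ‖e.basis i‖)
    (hshrink : ∀ (x : StrongDual 𝕜 F) (ε : ℝ), 0 < ε →
      ∃ n₀, ∀ n ≥ n₀, ∀ y, ‖x (y - e.proj (Finset.range n) y)‖ ≤ ε * ‖y‖)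
    {M : Submodule 𝕜 (StrongDual 𝕜 F)} (hM : ¬ FiniteDimensional 𝕜 M) (n₀ : ℕ) {η : ℝ}
    (hη : 0 < η) :
    ∃ x ∈ M, ‖x‖ = 1 ∧ (∀ i < n₀, x (e.basis i) = 0) ∧
      ∀ i, ‖x (e.basis i)‖ ≤ η * ‖e.basis i‖ := by
  by_contra! hcon
  have hsup : ∀ x ∈ M, (∀ i < n₀, x (e.basis i) = 0) → x ≠ 0 →
      ∃ i, η * ‖x‖ * ‖e.basis i‖ ≤ ‖x (e.basis i)‖ := by
    intro x hx hxe hx0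
    have hx0' : 0 < ‖x‖ := norm_pos_iff.2 hx0
    obtain ⟨i, hi⟩ := hcon (((‖x‖⁻¹ : ℝ) : 𝕜) • x) (M.smul_mem _ hx)
      (by rw [norm_smul, RCLike.norm_ofReal, abs_inv, abs_norm, inv_mul_cancel₀ hx0'.ne'])
      (fun i hi => by rw [smul_apply, hxe i hi, smul_zero])
    rw [smul_apply, norm_smul, RCLike.norm_ofReal, abs_inv, abs_norm, lt_inv_mul_iff₀ hx0'] at hi
    exact ⟨i, by linarith⟩
  have step : ∀ k n : ℕ, n₀ ≤ n → ∃ (m : ℕ) (d : StrongDual 𝕜 F × ℕ), n < m ∧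
      (d.1 ∈ M ∧ ‖d.1‖ = 1 ∧ (∀ i < n, d.1 (e.basis i) = 0) ∧
        (∀ i, m ≤ i → ‖d.1 (e.basis i)‖ ≤ η / 4 * (1 / 2) ^ k * ‖e.basis i‖) ∧
        d.2 ∈ Finset.Ico n m ∧ η * ‖e.basis d.2‖ < ‖d.1 (e.basis d.2)‖) := by
    intro k n hn
    obtain ⟨x, hxM, hx1, hxn⟩ := exists_mem_norm_eq_one_forall_lt_apply_eq_zero hM e.basis n
    obtain ⟨p, hp⟩ := hcon x hxM hx1 fun i hi => hxn i (hi.trans_le hn)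
    obtain ⟨m₀, hm₀⟩ := hshrink x (η / 4 * (1 / 2) ^ k) (by positivity)
    have hnp : n ≤ p := by
      by_contra! h
      rw [hxn p h, norm_zero] at hp
      exact hp.not_ge (by positivity)
    refine ⟨max m₀ (p + 1), (x, p), by omega, hxM, hx1, hxn, fun i hi => ?_,
      Finset.mem_Ico.2 ⟨hnp, by omega⟩, hp⟩
    have h1 := hm₀ _ (le_max_left m₀ (p + 1)) (e.basis i)
    classical
    rwa [e.proj_apply_basis_mem, if_neg (by simpa using hi), sub_zero] at h1
  obtain ⟨j, d, hj, hj0, hQ⟩ := exists_strictMono_forall_consecutive _ n₀ step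
  choose hdM hd1 hdlow hdhigh hdmem hdη using hQ
  set x : ℕ → StrongDual 𝕜 F := fun k => (d k).1 with hx
  set p : ℕ → ℕ := fun k => (d k).2 with hp
  have hoff : ∀ k i, i ∉ Finset.Ico (j k) (j (k + 1)) →
      ‖x k (e.basis i)‖ ≤ η / 4 * (1 / 2) ^ k * ‖e.basis i‖ := by
    intro k i hi
    rcases lt_or_ge i (j k) with h | h
    · rw [hx]
      simp only [hdlow k i h, norm_zero]
      positivity
    · exact hdhigh k i (not_lt.1 fun h' => hi (Finset.mem_Ico.2 ⟨h, h'⟩))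
  have hbasis : ∀ i, 0 < ‖e.basis i‖ := e.norm_basis_pos
  have hη1 : η ≤ 1 := by
    have h1 := (hdη 0).le.trans ((d 0).1.le_opNorm _)
    rw [hd1 0] at h1
    exact le_of_mul_le_mul_right h1 (hbasis _)
  have hne : ∀ k, x k (e.basis (p k)) ≠ 0 := fun k =>
    norm_pos_iff.1 (lt_of_le_of_lt (by positivity) (hdη k))
  -- The multiple of the basis vector at `p k` on which `x k` takes the value `η`.
  let τ : ℕ → 𝕜 := fun k => ((η : ℝ) : 𝕜) / x k (e.basis (p k))
  have hτ : ∀ k, ‖τ k‖ * ‖e.basis (p k)‖ ≤ 1 := by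
    intro k
    rw [norm_div, RCLike.norm_ofReal, abs_of_pos hη, div_mul_eq_mul_div]
    exact div_le_one_of_le₀ (hdη k).le (norm_nonneg _)
  obtain ⟨a, ha, ha'⟩ := hj.exists_glue fun k i => if i = p k then τ k else 0
  have hblock : ∀ k, block e.basis j a k = τ k • e.basis (p k) := by
    intro k
    rw [block_congr _ (ha k), block, Finset.sum_eq_single (p k)]
    · simp
    · intro i _ hi
      simp [hi]
    · exact fun h => absurd (hdmem k) h
  refine hstar.not_forall_exists_le_re hj (a := a) (A := 1 / β) (B := 1) (c := η / 2) (D := 2 / η)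
    (fun i => ?_) (fun k => ?_) (by positivity) fun N => ⟨∑ k ∈ Finset.range N, x k, ?_, ?_⟩
  · rcases ha' i with h | ⟨k, -, h⟩
    · rw [h, norm_zero]; positivity
    · rw [h]
      split_ifs
      · rw [le_div_iff₀ hβ]
        exact (mul_le_mul_of_nonneg_left (hβe (p k)) (norm_nonneg _)).trans (hτ k)
      · rw [norm_zero]; positivity
  · rw [hblock, norm_smul]
    exact hτ k
  · rcases eq_or_ne (∑ k ∈ Finset.range N, x k) 0 with h0 | h0
    · rw [h0, norm_zero]; positivity
    obtain ⟨i, hi⟩ := hsup (∑ k ∈ Finset.range N, x k) (M.sum_mem fun k _ => hdM k)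
      (fun i hi => by
        rw [sum_apply]
        refine Finset.sum_eq_zero fun k _ => hdlow k i (hi.trans_le ?_)
        rw [← hj0]
        exact hj.monotone k.zero_le) h0
    -- At most one of the functionals is not small at a given basis vector.
    have hone : ∑ k ∈ Finset.range N, (if i ∈ Finset.Ico (j k) (j (k + 1)) then ‖e.basis i‖ else 0)
        ≤ ‖e.basis i‖ := by
      by_cases h : ∃ l, i ∈ Finset.Ico (j l) (j (l + 1))
      · obtain ⟨l, hl⟩ := h
        calc _ ≤ ∑ k ∈ Finset.range N, if k = l then ‖e.basis i‖ else 0 := by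
              refine Finset.sum_le_sum fun k _ => ?_
              by_cases hk : i ∈ Finset.Ico (j k) (j (k + 1))
              · rw [if_pos hk, if_pos (hj.eq_of_mem_Ico_succ hk hl)]
              · rw [if_neg hk]
                split_ifs <;> positivity
          _ ≤ ‖e.basis i‖ := by
              rw [Finset.sum_ite_eq']
              split_ifs
              · exact le_rfl
              · exact norm_nonneg _
      · rw [Finset.sum_eq_zero]
        · exact norm_nonneg _
        · exact fun k _ => if_neg fun hk => h ⟨k, hk⟩
    have hX : ‖(∑ k ∈ Finset.range N, x k) (e.basis i)‖ ≤ 2 * ‖e.basis i‖ := by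
      rw [sum_apply]
      calc _ ≤ ∑ k ∈ Finset.range N, (η / 4 * (1 / 2) ^ k * ‖e.basis i‖ +
              if i ∈ Finset.Ico (j k) (j (k + 1)) then ‖e.basis i‖ else 0) := by
            refine norm_sum_le_of_le _ fun k _ => ?_
            split_ifs with h
            · have h1 := (x k).le_opNorm (e.basis i)
              rw [show ‖x k‖ = 1 from hd1 k, one_mul] at h1
              exact h1.trans (le_add_of_nonneg_left (by positivity))
            · rw [add_zero]
              exact hoff k i h
        _ ≤ 2 * (η / 4) * ‖e.basis i‖ + ‖e.basis i‖ := by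
            rw [Finset.sum_add_distrib, ← Finset.sum_mul]
            gcongr
            exact sum_range_mul_half_pow_le (by positivity) N
        _ ≤ 2 * ‖e.basis i‖ := by nlinarith [hbasis i]
    have h1 := le_of_mul_le_mul_right (hi.trans hX) (hbasis i)
    rwa [le_div_iff₀' hη]
  · intro l hl
    have hsmall : ∀ k, k ≠ l → ‖x k (τ l • e.basis (p l))‖ ≤ η / 4 * (1 / 2) ^ k := by
      intro k hkl
      have h1 := hoff k (p l) fun h => hkl (hj.eq_of_mem_Ico_succ h (hdmem l))
      rw [map_smul, norm_smul]
      calc _ ≤ ‖τ l‖ * (η / 4 * (1 / 2) ^ k * ‖e.basis (p l)‖) := by gcongr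
        _ = η / 4 * (1 / 2) ^ k * (‖τ l‖ * ‖e.basis (p l)‖) := by ring
        _ ≤ η / 4 * (1 / 2) ^ k := mul_le_of_le_one_right (by positivity) (hτ l)
    have hl' : l ∈ Finset.range N := Finset.mem_range.2 hl
    have hrest : ‖∑ k ∈ (Finset.range N).erase l, x k (τ l • e.basis (p l))‖ ≤ 2 * (η / 4) :=
      (norm_sum_le_of_le _ fun k hk => hsmall k (Finset.ne_of_mem_erase hk)).trans
        ((Finset.sum_le_sum_of_subset_of_nonneg (Finset.erase_subset _ _) fun _ _ _ => by
          positivity).trans (sum_range_mul_half_pow_le (by positivity) N))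
    have hdiag : x l (τ l • e.basis (p l)) = ((η : ℝ) : 𝕜) := by
      rw [map_smul, smul_eq_mul, div_mul_cancel₀ _ (hne l)]
    rw [hblock, sum_apply, ← Finset.add_sum_erase _ _ hl', hdiag, map_add, RCLike.ofReal_re]
    have h1 := (RCLike.abs_re_le_norm _).trans hrest
    have h2 := (abs_le.1 h1).1
    linarith

/-- A norm-one functional that is small on all normalised basis vectors is almost normed by a
vector with small coefficients: the number of large coefficients of a norming vector is bounded, so
that they hardly contribute and may be discarded. -/
theorem exists_small_coeff_le_norm_apply {K : ℝ} (hK : ∀ A : Finset ℕ, ‖e.proj A‖ ≤ K)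
    {δ : ℝ} {N : ℕ} (hδ : 0 < δ)
    (hN : ∀ A : Finset ℕ, ‖∑ i ∈ A, e.basis i‖ ≤ 4 * K / δ → A.card < N)
    {x : StrongDual 𝕜 F} (hx1 : ‖x‖ = 1) {n m : ℕ} (hnm : n ≤ m)
    (hxn : ∀ i < n, x (e.basis i) = 0)
    (hxe : ∀ i, ‖x (e.basis i)‖ ≤ 1 / (4 * (N * K + 1)) * ‖e.basis i‖)
    (hxm : ∀ y, ‖x (y - e.proj (Finset.range m) y)‖ ≤ 1 / 4 * ‖y‖) :
    ∃ α : ℕ → 𝕜, (∀ i, ‖α i‖ ≤ δ) ∧ ‖∑ i ∈ Finset.Ico n m, α i • e.basis i‖ ≤ K ∧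
      1 / 4 ≤ ‖x (∑ i ∈ Finset.Ico n m, α i • e.basis i)‖ := by
  classical
  have hK0 : 0 ≤ K := (norm_nonneg _).trans (hK ∅)
  obtain ⟨u, hu, hxu⟩ : ∃ u, ‖u‖ < 1 ∧ 3 / 4 < ‖x u‖ :=
    x.exists_lt_apply_of_lt_opNorm (by rw [hx1]; norm_num)
  let α : ℕ → 𝕜 := fun i => if ‖e.coord i u‖ < δ then e.coord i u else 0
  let R : Finset ℕ := {i ∈ Finset.Ico n m | ¬ ‖e.coord i u‖ < δ}
  have hα : ∑ i ∈ Finset.Ico n m, α i • e.basis i =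
      e.proj {i ∈ Finset.Ico n m | ‖e.coord i u‖ < δ} u := by
    rw [e.proj_apply, Finset.sum_filter]
    refine Finset.sum_congr rfl fun i _ => ?_
    simp only [α]
    split_ifs <;> simp
  have hxR : ‖x (e.proj R u)‖ ≤ 1 / 4 := by
    have hcard : R.card < N := by
      refine hN R ?_
      rw [le_div_iff₀' hδ]
      refine (e.mul_norm_sum_basis_le hK u fun i hi =>
        not_lt.1 (Finset.mem_filter.1 hi).2).trans ?_
      have := mul_le_of_le_one_right hK0 hu.le
      linarith
    rw [e.proj_apply, map_sum]
    calc _ ≤ ∑ i ∈ R, 1 / (4 * (N * K + 1)) * K := by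
          refine norm_sum_le_of_le _ fun i _ => ?_
          rw [map_smul, norm_smul]
          calc _ ≤ ‖e.coord i u‖ * (1 / (4 * (N * K + 1)) * ‖e.basis i‖) := by
                gcongr; exact hxe i
            _ = 1 / (4 * (N * K + 1)) * (‖e.coord i u‖ * ‖e.basis i‖) := by ring
            _ ≤ 1 / (4 * (N * K + 1)) * K := by
                gcongr
                exact (e.norm_coord_mul_norm_basis_le hK i u).trans
                  (mul_le_of_le_one_right hK0 hu.le)
      _ = R.card * (1 / (4 * (N * K + 1)) * K) := by rw [Finset.sum_const, nsmul_eq_mul]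
      _ ≤ N * (1 / (4 * (N * K + 1)) * K) := by gcongr
      _ ≤ 1 / 4 := by
          rw [← mul_assoc, mul_one_div, div_mul_eq_mul_div, div_le_div_iff₀ (by positivity)
            (by norm_num)]
          linarith
  have hsplit : x (e.proj (Finset.range m) u) =
      x (∑ i ∈ Finset.Ico n m, α i • e.basis i) + x (e.proj R u) := by
    rw [hα, ← map_add, e.proj_apply, e.proj_apply, e.proj_apply,
      Finset.sum_filter_add_sum_filter_not, ← Finset.sum_range_add_sum_Ico _ hnm, map_add,
      map_sum, Finset.sum_eq_zero, zero_add]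
    intro i hi
    rw [map_smul, hxn i (Finset.mem_range.1 hi), smul_zero]
  refine ⟨α, fun i => ?_, ?_, ?_⟩
  · simp only [α]
    split_ifs with h
    · exact h.le
    · rw [norm_zero]; exact hδ.le
  · rw [hα]
    exact ((e.proj _).le_of_opNorm_le (hK _) u).trans (mul_le_of_le_one_right hK0 hu.le)
  · have h1 := hxm u
    rw [map_sub, hsplit] at h1
    have h2 := norm_sub_norm_le (x u) (x (∑ i ∈ Finset.Ico n m, α i • e.basis i) + x (e.proj R u))
    have h3 := norm_add_le (x (∑ i ∈ Finset.Ico n m, α i • e.basis i)) (x (e.proj R u))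
    linarith

end Dual

/-! ### Saturation of the dual -/

theorem mainTheorem6 {𝕜 : Type*} [RCLike 𝕜] {F : Type*} [NormedAddCommGroup F]
    [NormedSpace 𝕜 F] [CompleteSpace F] (e : UnconditionalSchauderBasis ℕ 𝕜 F)
    (hstar : PropertyStar 𝕜 e.basis) (hgrow : BlowsUpOnSuccessiveSets e.basis) :
    IsSaturated 𝕜 (lp (fun _ : ℕ => 𝕜) 1) (StrongDual 𝕜 F) := by
  intro M hMc hM
  obtain ⟨K, hK⟩ := e.exists_norm_proj_le
  obtain ⟨β, hβ, hβe⟩ := hgrow.exists_pos_forall_le_norm e hK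
  have hshrink : ∀ (x : StrongDual 𝕜 F) (ε : ℝ), 0 < ε →
      ∃ n₀, ∀ n ≥ n₀, ∀ y, ‖x (y - e.proj (Finset.range n) y)‖ ≤ ε * ‖y‖ := fun x ε hε =>
    e.exists_forall_norm_apply_sub_proj_le hK hstar hβ hβe x hε
  have step : ∀ k n : ℕ, 0 ≤ n → ∃ (m : ℕ) (d : StrongDual 𝕜 F × (ℕ → 𝕜)), n < m ∧
      (d.1 ∈ M ∧ ‖d.1‖ = 1 ∧ (∀ i < n, d.1 (e.basis i) = 0) ∧
        (∀ y, ‖d.1 (y - e.proj (Finset.range m) y)‖ ≤ 1 / ((k : ℝ) + 1) * ‖y‖) ∧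
        (∀ i, ‖d.2 i‖ ≤ 1 / ((k : ℝ) + 1)) ∧
        ‖∑ i ∈ Finset.Ico n m, d.2 i • e.basis i‖ ≤ K ∧
        1 / 4 ≤ ‖d.1 (∑ i ∈ Finset.Ico n m, d.2 i • e.basis i)‖) := by
    intro k n _
    have hK0 : 0 ≤ K := (norm_nonneg _).trans (hK ∅)
    -- `N` bounds the number of coefficients of modulus at least `1 / (k + 1)` in the unit ball; only
    -- then is the smallness of `x` on the basis chosen.
    obtain ⟨N, hN⟩ := hgrow.exists_forall_card_lt e hK (4 * K / (1 / ((k : ℝ) + 1)))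
    obtain ⟨x, hxM, hx1, hxn, hxe⟩ := exists_mem_norm_eq_one_forall_norm_apply_basis_le e hstar hβ
      hβe hshrink hM n (η := 1 / (4 * (N * K + 1))) (by positivity)
    obtain ⟨m₁, hm₁⟩ := hshrink x (1 / ((k : ℝ) + 1)) (by positivity)
    obtain ⟨m₂, hm₂⟩ := hshrink x (1 / 4) (by norm_num)
    let m := max (n + 1) (max m₁ m₂)
    obtain ⟨α, hα⟩ := exists_small_coeff_le_norm_apply e hK (δ := 1 / ((k : ℝ) + 1)) (by positivity)
      hN hx1 (m := m) (by omega) hxn hxe (hm₂ m (by omega))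
    exact ⟨m, (x, α), by omega, hxM, hx1, hxn, hm₁ m (by omega), hα⟩
  obtain ⟨j, d, hj, -, hQ⟩ := exists_strictMono_forall_consecutive _ 0 step
  choose hdM hd1 hdlow hdhigh hdcoeff hdK hdx using hQ
  obtain ⟨φ, hφ, C, hC, hφC⟩ := hstar.exists_subseq_norm_sum_le hj (α := fun k => (d k).2)
    tendsto_one_div_add_atTop_nhds_zero_nat (fun k i _ => hdcoeff k i)
    (c := 1 / 4) (by norm_num)
    (fun k => (hdx k).trans ((d k).1.le_of_opNorm_le (hd1 k).le _ |>.trans (one_mul _).le)) hdK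
  -- Past `K₀` the values of a functional on later blocks are dominated by the diagonal ones.
  obtain ⟨K₀, hK₀⟩ := exists_nat_gt (8 * C)
  let ψ : ℕ → ℕ := fun k => φ (k + K₀)
  have hψ : StrictMono ψ := fun k l hkl => hφ (by omega)
  have hψK : ∀ k, K₀ ≤ ψ k := fun k => (Nat.le_add_left _ _).trans (hφ.id_le _)
  let x : ℕ → StrongDual 𝕜 F := fun k => (d (ψ k)).1
  let w : ℕ → F := fun k => block e.basis j (d (ψ k)).2 (ψ k)
  have hwC : ∀ (s : Finset ℕ) (θ : ℕ → 𝕜), (∀ k ∈ s, ‖θ k‖ ≤ 1) → ‖∑ k ∈ s, θ k • w k‖ ≤ C := by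
    intro s θ hθ
    have h1 := hφC (s.map (addRightEmbedding K₀)) (fun k => θ (k - K₀)) (by simpa using hθ)
    simpa [Finset.sum_map] using h1
  have hlow : ∀ k l, l < k → x k (w l) = 0 := by
    intro k l hlk
    change (d (ψ k)).1 (∑ i ∈ Finset.Ico (j (ψ l)) (j (ψ l + 1)), (d (ψ l)).2 i • e.basis i) = 0
    rw [map_sum]
    refine Finset.sum_eq_zero fun i hi => ?_
    have h1 : j (ψ l + 1) ≤ j (ψ k) := hj.monotone (hψ hlk)
    rw [map_smul, hdlow (ψ k) i ((Finset.mem_Ico.1 hi).2.trans_le h1), smul_zero]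
  have htail : ∀ (k : ℕ) (s : Finset ℕ) (θ : ℕ → 𝕜), (∀ l ∈ s, k < l ∧ ‖θ l‖ ≤ 1) →
      ‖x k (∑ l ∈ s, θ l • w l)‖ ≤ 1 / 4 / 2 := by
    intro k s θ hs
    have hproj : e.proj (Finset.range (j (ψ k + 1))) (∑ l ∈ s, θ l • w l) = 0 := by
      classical
      rw [map_sum]
      refine Finset.sum_eq_zero fun l hl => ?_
      change e.proj _ (θ l • ∑ i ∈ Finset.Ico (j (ψ l)) (j (ψ l + 1)), (d (ψ l)).2 i • e.basis i) = 0
      rw [map_smul, map_sum, Finset.sum_eq_zero, smul_zero]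
      intro i hi
      have h1 : j (ψ k + 1) ≤ j (ψ l) := hj.monotone (hψ (hs l hl).1)
      have h2 : i ∉ Finset.range (j (ψ k + 1)) := fun h =>
        (Finset.mem_range.1 h).not_ge (h1.trans (Finset.mem_Ico.1 hi).1)
      rw [map_smul, e.proj_apply_basis_mem, if_neg h2, smul_zero]
    have h1 := hdhigh (ψ k) (∑ l ∈ s, θ l • w l)
    rw [hproj, sub_zero] at h1
    have h2 : (K₀ : ℝ) ≤ ψ k := by exact_mod_cast hψK k
    calc ‖x k (∑ l ∈ s, θ l • w l)‖ ≤ 1 / ((ψ k : ℝ) + 1) * ‖∑ l ∈ s, θ l • w l‖ := h1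
      _ ≤ 1 / ((ψ k : ℝ) + 1) * C := by gcongr; exact hwC s θ fun l hl => (hs l hl).2
      _ ≤ 1 / 4 / 2 := by
          rw [div_mul_eq_mul_div, one_mul, div_le_iff₀ (by positivity)]
          linarith
  refine exists_le_nonempty_equiv_lp_one hMc (x := x) (fun k => hdM (ψ k))
    (fun k => (hd1 (ψ k)).le) (c := 1 / 8 / C) (by positivity) fun n b => ?_
  have h1 := sum_norm_le_mul_norm_sum_of_norm_sum_le (x := x) (w := w) (by norm_num) hwC hlow
    (fun k => hdx (ψ k)) htail (Finset.range n) b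
  rw [div_mul_eq_mul_div, div_le_iff₀ hC]
  linarith
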